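/- Let $k\in\mathbb N$ and let $\Lambda$ be a row-finite $k$-graph with no sources, that is, $v\Lambda^n:=\{\lambda\in\Lambda: r(\lambda)=v,\ d(\lambda)=n\}$ is finite and non-empty for every vertex $v\in\Lambda^0$ and every $n\in\mathbb N^k$. Let $\mathcal TC^*(\Lambda)$ be the $C^*$-algebra generated by a universal Toeplitz–Cuntz–Krieger $\Lambda$-family $\{t_\lambda:\lambda\in\Lambda\}$, that is, a universal family of partial isometries such that the $t_v$ ($v\in\Lambda^0$) are mutually orthogonal projections; $t_\lambda t_\mu=t_{\lambda\mu}$ whenever $s(\lambda)=r(\mu)$; $t_\lambda^*t_\lambda=t_{s(\lambda)}$; $t_v\ge\sum_{\lambda\in v\Lambda^n}t_\lambda t_\lambda^*$ for $v\in\Lambda^0$, $n\in\mathbb N^k$; and $t_\mu^*t_\nu=\sum t_\eta t_\zeta^*$, the sum being over all pairs $(\eta,\zeta)$ with $\mu\eta=\nu\zeta$ and $d(\mu\eta)=d(\mu)\vee d(\nu)$. A finite set $E\subset\Lambda$ is called finite exhaustive if there is a vertex $v=:r(E)$ such that $E\subset v\Lambda$ and for every $\mu\in v\Lambda$ there are $\lambda\in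 E$ and $\alpha,\beta\in\Lambda$ with $\mu\alpha=\lambda\beta$ and $d(\mu\alpha)=d(\mu)\vee d(\lambda)$. For a collection $\mathcal F$ of finite exhaustive sets, Sims' relative Cuntz–Krieger algebra $C^*(\Lambda;\mathcal F)$ is the quotient of $\mathcal TC^*(\Lambda)$ by the closed two-sided ideal generated by \[ \Big\{\prod_{\lambda\in E}\big(t_{r(E)}-t_\lambda t_\lambda^*\big): E\in\mathcal F\Big\}. \] Suppose that $J\sqcup K$ is a partition of $\{1,\dots,k\}$ and let $\mathcal E=\{v\Lambda^{e_i}: v\in\Lambda^0,\ i\in K\}$, which is a collection of finite exhaustive sets. Then $C^*(\Lambda;\mathcal E)$ is the quotient of $\mathcal TC^*(\Lambda)$ by the closed two-sided ideal generated by \[ \Big\{t_v-\sum_{e\in v\Lambda^{e_i}}t_e t_e^*: v\in\Lambda^0,\ i\in K\Big\}; \] that is, the two closed ideals coincide, and the identity of $\mathcal TC^*(\Lambda)$ induces an isometric $*$-isomorphism between the two quotient $C^*$-algebras. -/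

import Mathlib

open CategoryTheory Filter Topology
open scoped ENNReal

universe u v w

/-! ### Closed ideals of C⋆-algebras and their quotients -/

/-- A closed two-sided ideal of a (not necessarily unital) C⋆-algebra. -/
structure ClosedIdeal (A : Type u) [NonUnitalCStarAlgebra A] extends Submodule ℂ A where
  mul_mem_left : ∀ (a : A) {x : A}, x ∈ carrier → a * x ∈ carrier
  mul_mem_right : ∀ {x : A} (a : A), x ∈ carrier → x * a ∈ carrier
  isClosed : IsClosed carrier

namespace ClosedIdeal

section

variable {A : Type u} [NonUnitalCStarAlgebra A]

/-- The closed two-sided ideal generated by a set: the intersection of all closed two-sided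
ideals containing it. -/
def generatedBy (S : Set A) : ClosedIdeal A where
  toSubmodule := ⨅ I : {I : ClosedIdeal A // S ⊆ I.carrier}, I.1.toSubmodule
  mul_mem_left := by
    intro a x hx
    have hx' : x ∈ ⨅ I : {I : ClosedIdeal A // S ⊆ I.carrier}, I.1.toSubmodule := hx
    change a * x ∈ ⨅ I : {I : ClosedIdeal A // S ⊆ I.carrier}, I.1.toSubmodule
    rw [Submodule.mem_iInf] at hx' ⊢
    exact fun I => I.1.mul_mem_left a (hx' I)
  mul_mem_right := by
    intro x a hx
    have hx' : x ∈ ⨅ I : {I : ClosedIdeal A // S ⊆ I.carrier}, I.1.toSubmodule := hx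
    change x * a ∈ ⨅ I : {I : ClosedIdeal A // S ⊆ I.carrier}, I.1.toSubmodule
    rw [Submodule.mem_iInf] at hx' ⊢
    exact fun I => I.1.mul_mem_right a (hx' I)
  isClosed := by
    change IsClosed ((⨅ I : {I : ClosedIdeal A // S ⊆ I.carrier}, I.1.toSubmodule :
      Submodule ℂ A) : Set A)
    rw [Submodule.coe_iInf]
    exact isClosed_iInter fun I => I.1.isClosed

theorem subset_generatedBy (S : Set A) : S ⊆ (generatedBy S).carrier := by
  intro x hx
  change x ∈ ⨅ I : {I : ClosedIdeal A // S ⊆ I.carrier}, I.1.toSubmodule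
  rw [Submodule.mem_iInf]
  exact fun I => I.2 hx

theorem generatedBy_le (S : Set A) (I : ClosedIdeal A) (h : S ⊆ I.carrier) :
    (generatedBy S).carrier ⊆ I.carrier := by
  intro x hx
  have hx' : x ∈ ⨅ I : {I : ClosedIdeal A // S ⊆ I.carrier}, I.1.toSubmodule := hx
  rw [Submodule.mem_iInf] at hx'
  exact hx' ⟨I, h⟩

variable (I : ClosedIdeal A)

/-- The self-adjoint part `I ∩ I*` of a closed ideal. -/
def starPart : NonUnitalStarSubalgebra ℂ A where
  carrier := {x | x ∈ I.carrier ∧ star x ∈ I.carrier}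
  add_mem' := fun ⟨h1, h2⟩ ⟨h3, h4⟩ =>
    ⟨I.add_mem h1 h3, by rw [star_add]; exact I.add_mem h2 h4⟩
  zero_mem' := ⟨I.zero_mem, by rw [star_zero]; exact I.zero_mem⟩
  mul_mem' := fun ⟨h1, h2⟩ _ =>
    ⟨I.mul_mem_right _ h1, by rw [star_mul]; exact I.mul_mem_left _ h2⟩
  smul_mem' := fun c _ ⟨h1, h2⟩ =>
    ⟨I.smul_mem c h1, by rw [star_smul]; exact I.smul_mem _ h2⟩
  star_mem' := fun ⟨h1, h2⟩ => ⟨h2, by rw [star_star]; exact h1⟩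

theorem isClosed_starPart : IsClosed (I.starPart : Set A) :=
  I.isClosed.inter (I.isClosed.preimage continuous_star)

/-- A closed ideal has approximate identities, on its self-adjoint part. -/
theorem exists_approx (b : A) (hb : b ∈ I.starPart) (ε : ℝ) (hε : 0 < ε) :
    ∃ e : A, e ∈ I.carrier ∧ star e = e ∧ ‖e‖ ≤ 1 ∧ (∃ c : A, e = star c * c) ∧
      ‖b - b * e‖ < ε := by
  have : IsClosed (I.starPart : Set A) := I.isClosed_starPart
  let _ : NonUnitalCStarAlgebra I.starPart :=
    NonUnitalStarSubalgebra.nonUnitalCStarAlgebra I.starPart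
  let _ := CStarAlgebra.spectralOrder I.starPart
  have := CStarAlgebra.spectralOrderedRing I.starPart
  have h := CStarAlgebra.increasingApproximateUnit I.starPart
  have h1 := (h.tendsto_mul_left ⟨b, hb⟩).eventually (Metric.ball_mem_nhds _ hε)
  have := h.neBot
  obtain ⟨e, ⟨he1, he2⟩, he3⟩ := ((h1.and h.eventually_norm).and h.eventually_nonneg).exists
  obtain ⟨c, hc⟩ := CStarAlgebra.nonneg_iff_eq_star_mul_self.1 he3
  have hs : star e = e := by rw [hc, star_mul, star_star]
  refine ⟨e, e.2.1, congrArg Subtype.val hs, he2, ⟨c, congrArg Subtype.val hc⟩, ?_⟩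
  have he1' : dist ((⟨b, hb⟩ : I.starPart) * e) ⟨b, hb⟩ < ε := he1
  rw [dist_comm, dist_eq_norm] at he1'
  exact he1'

/-- Closed two-sided ideals of C⋆-algebras are self-adjoint. -/
theorem star_mem {x : A} (hx : x ∈ I.carrier) : star x ∈ I.carrier := by
  have hb : x * star x ∈ I.starPart :=
    ⟨I.mul_mem_right _ hx, by rw [star_mul, star_star]; exact I.mul_mem_right _ hx⟩
  rw [← I.isClosed.closure_eq, Metric.mem_closure_iff]
  intro ε hε
  obtain ⟨e, heI, hes, he1, -, hbe⟩ := I.exists_approx _ hb (ε ^ 2 / 2) (by positivity)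
  refine ⟨star x * e, I.mul_mem_left _ heI, ?_⟩
  rw [dist_eq_norm]
  have h1 : star (star x - star x * e) * (star x - star x * e)
      = (x * star x - x * star x * e) - e * (x * star x - x * star x * e) := by
    simp only [star_sub, star_star, star_mul, hes]
    noncomm_ring
  have h2 : ‖star x - star x * e‖ * ‖star x - star x * e‖ < ε * ε := by
    rw [← CStarRing.norm_star_mul_self, h1]
    calc _ ≤ ‖x * star x - x * star x * e‖ + ‖e‖ * ‖x * star x - x * star x * e‖ :=
          (norm_sub_le _ _).trans (by gcongr; exact norm_mul_le _ _)
      _ ≤ ‖x * star x - x * star x * e‖ + 1 * ‖x * star x - x * star x * e‖ := by gcongr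
      _ < ε * ε := by nlinarith
  exact lt_of_mul_self_lt_mul_self₀ hε.le h2

/-- The quotient of a C⋆-algebra by a closed two-sided ideal. -/
def Quotient (I : ClosedIdeal A) : Type u := A ⧸ I.toSubmodule

/-- The class of an element in the quotient. -/
def toQuot (a : A) : I.Quotient := Submodule.Quotient.mk a

noncomputable instance : NormedAddCommGroup I.Quotient :=
  haveI : IsClosed (I.toSubmodule : Set A) := I.isClosed
  inferInstanceAs (NormedAddCommGroup (A ⧸ I.toSubmodule))

noncomputable instance : NormedSpace ℂ I.Quotient :=
  inferInstanceAs (NormedSpace ℂ (A ⧸ I.toSubmodule))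

instance : CompleteSpace I.Quotient :=
  inferInstanceAs (CompleteSpace (A ⧸ I.toSubmodule))

theorem toQuot_surjective : Function.Surjective I.toQuot := Submodule.mkQ_surjective _

theorem toQuot_eq {a b : A} : I.toQuot a = I.toQuot b ↔ a - b ∈ I.carrier :=
  Submodule.Quotient.eq I.toSubmodule

theorem toQuot_add (a b : A) : I.toQuot (a + b) = I.toQuot a + I.toQuot b := rfl

theorem toQuot_smul (c : ℂ) (a : A) : I.toQuot (c • a) = c • I.toQuot a := rfl

theorem norm_toQuot_le (a : A) : ‖I.toQuot a‖ ≤ ‖a‖ := Submodule.Quotient.norm_mk_le _ a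

theorem exists_norm_lt (x : I.Quotient) {ε : ℝ} (hε : 0 < ε) :
    ∃ a, I.toQuot a = x ∧ ‖a‖ < ‖x‖ + ε :=
  Submodule.Quotient.norm_mk_lt (S := I.toSubmodule) x hε

instance : Mul I.Quotient where
  mul := Quotient.map₂ (· * ·) (by
    intro a b hab c d hcd
    have h1 : a - b ∈ I.carrier := (Submodule.quotientRel_def I.toSubmodule).1 hab
    have h2 : c - d ∈ I.carrier := (Submodule.quotientRel_def I.toSubmodule).1 hcd
    refine (Submodule.quotientRel_def I.toSubmodule).2 ?_
    have h3 : a * c - b * d = (a - b) * c + b * (c - d) := by noncomm_ring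
    rw [h3]
    exact I.add_mem (I.mul_mem_right _ h1) (I.mul_mem_left _ h2))

theorem toQuot_mul (a b : A) : I.toQuot (a * b) = I.toQuot a * I.toQuot b := rfl

noncomputable instance : NonUnitalNormedRing I.Quotient where
  __ := (inferInstance : NormedAddCommGroup I.Quotient)
  __ := (inferInstance : Mul I.Quotient)
  left_distrib x y z := by
    obtain ⟨a, rfl⟩ := I.toQuot_surjective x
    obtain ⟨b, rfl⟩ := I.toQuot_surjective y
    obtain ⟨c, rfl⟩ := I.toQuot_surjective z
    exact congrArg I.toQuot (mul_add a b c)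
  right_distrib x y z := by
    obtain ⟨a, rfl⟩ := I.toQuot_surjective x
    obtain ⟨b, rfl⟩ := I.toQuot_surjective y
    obtain ⟨c, rfl⟩ := I.toQuot_surjective z
    exact congrArg I.toQuot (add_mul a b c)
  zero_mul x := by
    obtain ⟨a, rfl⟩ := I.toQuot_surjective x
    exact congrArg I.toQuot (zero_mul a)
  mul_zero x := by
    obtain ⟨a, rfl⟩ := I.toQuot_surjective x
    exact congrArg I.toQuot (mul_zero a)
  mul_assoc x y z := by
    obtain ⟨a, rfl⟩ := I.toQuot_surjective x
    obtain ⟨b, rfl⟩ := I.toQuot_surjective y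
    obtain ⟨c, rfl⟩ := I.toQuot_surjective z
    exact congrArg I.toQuot (mul_assoc a b c)
  norm_mul_le x y := by
    have key : ∀ ε > 0, ‖x * y‖ ≤ (‖x‖ + ε) * (‖y‖ + ε) := by
      intro ε hε
      obtain ⟨a, rfl, ha⟩ := I.exists_norm_lt x hε
      obtain ⟨b, rfl, hb⟩ := I.exists_norm_lt y hε
      calc ‖I.toQuot a * I.toQuot b‖ ≤ ‖a * b‖ := I.norm_toQuot_le (a * b)
        _ ≤ ‖a‖ * ‖b‖ := norm_mul_le _ _
        _ ≤ _ := by gcongr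
    have hl : Tendsto (fun ε : ℝ => (‖x‖ + ε) * (‖y‖ + ε)) (𝓝[>] 0) (𝓝 (‖x‖ * ‖y‖)) := by
      have : Continuous (fun ε : ℝ => (‖x‖ + ε) * (‖y‖ + ε)) := by fun_prop
      simpa using (this.tendsto 0).mono_left nhdsWithin_le_nhds
    exact ge_of_tendsto hl (eventually_nhdsWithin_of_forall key)

noncomputable instance : StarRing I.Quotient where
  star := Quotient.map star (by
    intro a b hab
    have h1 : a - b ∈ I.carrier := (Submodule.quotientRel_def I.toSubmodule).1 hab
    refine (Submodule.quotientRel_def I.toSubmodule).2 ?_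
    rw [← star_sub]
    exact I.star_mem h1)
  star_involutive x := by
    obtain ⟨a, rfl⟩ := I.toQuot_surjective x
    exact congrArg I.toQuot (star_star a)
  star_mul x y := by
    obtain ⟨a, rfl⟩ := I.toQuot_surjective x
    obtain ⟨b, rfl⟩ := I.toQuot_surjective y
    exact congrArg I.toQuot (star_mul a b)
  star_add x y := by
    obtain ⟨a, rfl⟩ := I.toQuot_surjective x
    obtain ⟨b, rfl⟩ := I.toQuot_surjective y
    exact congrArg I.toQuot (star_add a b)

theorem toQuot_star (a : A) : I.toQuot (star a) = star (I.toQuot a) := rfl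

/-- For a positive contraction `e`, one has `‖y (1 - e)‖ ≤ ‖y‖` and `‖(1 - e) y‖ ≤ ‖y‖`. -/
theorem norm_sub_mul_le (e : A) (he : ‖e‖ ≤ 1) (hc : ∃ c : A, e = star c * c) (y : A) :
    ‖y - y * e‖ ≤ ‖y‖ ∧ ‖y - e * y‖ ≤ ‖y‖ := by
  let _ := CStarAlgebra.spectralOrder (Unitization ℂ A)
  have := CStarAlgebra.spectralOrderedRing (Unitization ℂ A)
  have hpos : (0 : Unitization ℂ A) ≤ (e : Unitization ℂ A) := by
    obtain ⟨c, rfl⟩ := hc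
    rw [Unitization.inr_mul, Unitization.inr_star]
    exact star_mul_self_nonneg _
  have hle : (e : Unitization ℂ A) ≤ 1 :=
    (CStarAlgebra.norm_le_one_iff_of_nonneg _ hpos).1 (by rw [Unitization.norm_inr]; exact he)
  have hone : ‖1 - (e : Unitization ℂ A)‖ ≤ 1 :=
    (CStarAlgebra.norm_le_one_iff_of_nonneg _ (sub_nonneg.2 hle)).2 (sub_le_self _ hpos)
  constructor
  · calc ‖y - y * e‖ = ‖(y : Unitization ℂ A) * (1 - (e : Unitization ℂ A))‖ := by
          rw [← Unitization.norm_inr (𝕜 := ℂ), Unitization.inr_sub, Unitization.inr_mul, mul_sub,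
            mul_one]
      _ ≤ ‖(y : Unitization ℂ A)‖ * ‖1 - (e : Unitization ℂ A)‖ := norm_mul_le _ _
      _ ≤ ‖(y : Unitization ℂ A)‖ * 1 := by gcongr
      _ = ‖y‖ := by rw [mul_one, Unitization.norm_inr]
  · calc ‖y - e * y‖ = ‖(1 - (e : Unitization ℂ A)) * (y : Unitization ℂ A)‖ := by
          rw [← Unitization.norm_inr (𝕜 := ℂ), Unitization.inr_sub, Unitization.inr_mul, sub_mul,
            one_mul]
      _ ≤ ‖1 - (e : Unitization ℂ A)‖ * ‖(y : Unitization ℂ A)‖ := norm_mul_le _ _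
      _ ≤ 1 * ‖(y : Unitization ℂ A)‖ := by gcongr
      _ = ‖y‖ := by rw [one_mul, Unitization.norm_inr]

instance : CStarRing I.Quotient where
  norm_mul_self_le x := by
    obtain ⟨a, rfl⟩ := I.toQuot_surjective x
    refine le_of_forall_pos_le_add fun ε hε => ?_
    obtain ⟨b, hb, hbn⟩ := I.exists_norm_lt (star (I.toQuot a) * I.toQuot a) (half_pos hε)
    have hi : star a * a - b ∈ I.carrier := I.toQuot_eq.1 hb.symm
    obtain ⟨e, heI, hes, he1, hec, hie⟩ :=
      I.exists_approx _ (⟨hi, I.star_mem hi⟩ : star a * a - b ∈ I.starPart) (ε / 2) (half_pos hε)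
    have hmk : I.toQuot a = I.toQuot (a - a * e) := by
      rw [I.toQuot_eq, sub_sub_cancel]
      exact I.mul_mem_left _ heI
    set i := star a * a - b with hidef
    have hfact : star (a - a * e) * (a - a * e)
        = ((b - b * e) - e * (b - b * e)) + ((i - i * e) - e * (i - i * e)) := by
      simp only [hidef, star_sub, star_mul, hes]
      noncomm_ring
    calc ‖I.toQuot a‖ * ‖I.toQuot a‖ ≤ ‖a - a * e‖ * ‖a - a * e‖ := by
          rw [hmk]
          gcongr <;> exact I.norm_toQuot_le _
      _ = ‖star (a - a * e) * (a - a * e)‖ := CStarRing.norm_star_mul_self.symm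
      _ ≤ ‖(b - b * e) - e * (b - b * e)‖ + ‖(i - i * e) - e * (i - i * e)‖ := by
          rw [hfact]; exact norm_add_le _ _
      _ ≤ ‖b‖ + ‖i - i * e‖ := by
          gcongr
          · exact (norm_sub_mul_le e he1 hec _).2.trans (norm_sub_mul_le e he1 hec _).1
          · exact (norm_sub_mul_le e he1 hec _).2
      _ ≤ ‖star (I.toQuot a) * I.toQuot a‖ + ε := by linarith

/-- The quotient of a C⋆-algebra by a closed two-sided ideal, with the quotient norm, is again a
C⋆-algebra. -/
noncomputable instance : NonUnitalCStarAlgebra I.Quotient where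
  smul_assoc c x y := by
    obtain ⟨a, rfl⟩ := I.toQuot_surjective x
    obtain ⟨b, rfl⟩ := I.toQuot_surjective y
    exact congrArg I.toQuot (smul_mul_assoc c a b)
  smul_comm c x y := by
    obtain ⟨a, rfl⟩ := I.toQuot_surjective x
    obtain ⟨b, rfl⟩ := I.toQuot_surjective y
    exact congrArg I.toQuot (mul_smul_comm c a b).symm
  star_smul c x := by
    obtain ⟨a, rfl⟩ := I.toQuot_surjective x
    exact congrArg I.toQuot (star_smul c a)

end

end ClosedIdeal

/-! ### Independence of the universe -/

/-- A C⋆-algebra whose underlying type is small has a copy in the smaller universe. -/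
theorem NonUnitalCStarAlgebra.exists_copy (C : Type w) [NonUnitalCStarAlgebra C] [Small.{u} C] :
    ∃ (D : Type u) (_ : NonUnitalCStarAlgebra D) (f : D →⋆ₙₐ[ℂ] C), Function.Bijective f := by
  obtain ⟨D, ⟨e'⟩⟩ := Small.equiv_small.{u} (α := C)
  let e : D ≃ C := e'.symm
  let _ : NonUnitalRing D := e.nonUnitalRing
  let _ : Module ℂ D := e.module ℂ
  have hadd : ∀ x y : D, e (x + y) = e x + e y := fun _ _ => e.apply_symm_apply _
  have hmul : ∀ x y : D, e (x * y) = e x * e y := fun _ _ => e.apply_symm_apply _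
  have hzero : e 0 = 0 := e.apply_symm_apply _
  have hsmul : ∀ (c : ℂ) (x : D), e (c • x) = c • e x := fun _ _ => e.apply_symm_apply _
  let f : D →ₙ+* C :=
    { toFun := e, map_mul' := hmul, map_zero' := hzero, map_add' := hadd }
  let fl : D →ₗ[ℂ] C := { toFun := e, map_add' := hadd, map_smul' := hsmul }
  let _ : NonUnitalNormedRing D := NonUnitalNormedRing.induced D C f e.injective
  let _ : NormedSpace ℂ D := NormedSpace.induced ℂ D C fl
  let _ : Star D := ⟨fun x => e.symm (star (e x))⟩
  have hstar : ∀ x : D, e (star x) = star (e x) := fun _ => e.apply_symm_apply _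
  let _ : StarRing D :=
    { star_involutive := fun x => e.injective (by rw [hstar, hstar, star_star])
      star_mul := fun x y => e.injective (by
        rw [hstar, hmul, hmul, hstar, hstar, StarMul.star_mul])
      star_add := fun x y => e.injective (by rw [hstar, hadd, hadd, hstar, hstar, star_add]) }
  have hnorm : ∀ x : D, ‖x‖ = ‖e x‖ := fun _ => rfl
  have hiso : Isometry e := AddMonoidHomClass.isometry_of_norm f fun x => rfl
  have : CompleteSpace D := by
    rw [completeSpace_iff_isComplete_range hiso.isUniformInducing, e.surjective.range_eq]
    exact isComplete_univ
  have : CStarRing D := ⟨fun x => by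
    rw [hnorm, hnorm, hmul, hstar]; exact CStarRing.norm_mul_self_le _⟩
  have : IsScalarTower ℂ D D := ⟨fun c x y => e.injective (by
    rw [smul_eq_mul, smul_eq_mul, hmul, hsmul, hsmul, hmul, smul_mul_assoc])⟩
  have : SMulCommClass ℂ D D := ⟨fun c x y => e.injective (by
    rw [smul_eq_mul, smul_eq_mul, hmul, hsmul, hsmul, hmul, mul_smul_comm])⟩
  have : StarModule ℂ D := ⟨fun c x => e.injective (by
    rw [hstar, hsmul, hsmul, hstar, star_smul])⟩
  let g : D →⋆ₙₐ[ℂ] C :=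
    { toFun := e
      map_smul' := hsmul
      map_zero' := hzero
      map_add' := hadd
      map_mul' := hmul
      map_star' := hstar }
  exact ⟨D, {}, g, e.bijective⟩

/-- Formal ⋆-polynomial expressions. -/
inductive StarTerm (X : Type u) : Type u
  | var : X → StarTerm X
  | zero : StarTerm X
  | add : StarTerm X → StarTerm X → StarTerm X
  | mul : StarTerm X → StarTerm X → StarTerm X
  | smul : ℂ → StarTerm X → StarTerm X
  | star : StarTerm X → StarTerm X

/-- The value of a ⋆-polynomial expression. -/
noncomputable def StarTerm.eval {X : Type u} {B : Type w} [NonUnitalCStarAlgebra B] (T : X → B) :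
    StarTerm X → B
  | var x => T x
  | zero => 0
  | add a b => a.eval T + b.eval T
  | mul a b => a.eval T * b.eval T
  | smul c a => c • a.eval T
  | star a => Star.star (a.eval T)

/-- The C⋆-subalgebra generated by a family indexed by `X` is no larger than the universe
of `X`. -/
theorem small_closure_adjoin {X : Type u} {B : Type w} [NonUnitalCStarAlgebra B] (T : X → B) :
    Small.{u} (NonUnitalStarAlgebra.adjoin ℂ (Set.range T)).topologicalClosure := by
  classical
  let g : (ℕ → StarTerm X) → B := fun f => limUnder atTop fun n => (f n).eval T
  refine small_subset (s := Set.range g) ?_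
  have h1 : ((NonUnitalStarAlgebra.adjoin ℂ (Set.range T) : NonUnitalStarSubalgebra ℂ B) : Set B)
      ⊆ Set.range (StarTerm.eval T) := by
    intro x hx
    induction hx using NonUnitalStarAlgebra.adjoin_induction with
    | mem x hx => obtain ⟨y, rfl⟩ := hx; exact ⟨.var y, rfl⟩
    | add x y _ _ hx hy =>
      obtain ⟨a, rfl⟩ := hx; obtain ⟨b, rfl⟩ := hy; exact ⟨.add a b, rfl⟩
    | zero => exact ⟨.zero, rfl⟩
    | mul x y _ _ hx hy =>
      obtain ⟨a, rfl⟩ := hx; obtain ⟨b, rfl⟩ := hy; exact ⟨.mul a b, rfl⟩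
    | smul c x _ hx => obtain ⟨a, rfl⟩ := hx; exact ⟨.smul c a, rfl⟩
    | star x _ hx => obtain ⟨a, rfl⟩ := hx; exact ⟨.star a, rfl⟩
  intro x hx
  obtain ⟨y, hy, hyx⟩ := mem_closure_iff_seq_limit.1 (closure_mono h1 hx)
  choose f hf using hy
  exact ⟨f, Tendsto.limUnder_eq (by simpa only [hf] using hyx)⟩

/-! ### Higher-rank graphs -/

/-- A `k`-graph with vertex set `V`: a small category together with a degree functor to `ℕ^k`
satisfying the factorisation property. A morphism `f : x ⟶ y` is a path with source `x` and
range `y`, so the path `f g` (first `g`, then `f`) is `g ≫ f`. -/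
structure KGraph (k : ℕ) (V : Type u) [Category.{v} V] where
  deg : ∀ {x y : V}, (x ⟶ y) → (Fin k → ℕ)
  deg_id : ∀ x : V, deg (𝟙 x) = 0
  deg_comp : ∀ {x y z : V} (f : y ⟶ z) (g : x ⟶ y), deg (g ≫ f) = deg f + deg g
  factorisation : ∀ {x z : V} (f : x ⟶ z) (m n : Fin k → ℕ), deg f = m + n →
    ∃! p : (Σ y : V, (y ⟶ z) × (x ⟶ y)),
      p.2.2 ≫ p.2.1 = f ∧ deg p.2.1 = m ∧ deg p.2.2 = n

namespace KGraph

section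

variable {k : ℕ} {V : Type u} [Category.{v} V]

/-- The set of all paths (morphisms) of a `k`-graph. -/
structure Path (_Λ : KGraph k V) : Type (max u v) where
  s : V
  r : V
  hom : s ⟶ r

variable {Λ : KGraph k V}

/-- The degree of a path. -/
def Path.d (l : Λ.Path) : Fin k → ℕ := Λ.deg l.hom

/-- The composite path `l m`, defined when `s(l) = r(m)`. -/
def Path.comp (l m : Λ.Path) (h : l.s = m.r) : Λ.Path :=
  ⟨m.s, l.r, m.hom ≫ eqToHom h.symm ≫ l.hom⟩

variable (Λ) in
/-- The vertex `v`, viewed as a path of degree `0`. -/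
def vertex (v : V) : Λ.Path := ⟨v, v, 𝟙 v⟩

theorem Path.d_comp (l m : Λ.Path) (h : l.s = m.r) : (l.comp m h).d = l.d + m.d := by
  obtain ⟨a, b, f⟩ := l
  obtain ⟨c, e, g⟩ := m
  dsimp only at h
  subst h
  simp [Path.comp, Path.d, Λ.deg_comp]

theorem Path.comp_vertex (l : Λ.Path) : l.comp (Λ.vertex l.s) rfl = l := by
  simp [Path.comp, vertex]

theorem Path.vertex_comp (l : Λ.Path) : (Λ.vertex l.r).comp l rfl = l := by
  simp [Path.comp, vertex]

theorem Path.exists_factor (l : Λ.Path) (m n : Fin k → ℕ) (h : l.d = m + n) :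
    ∃ (a b : Λ.Path) (hab : a.s = b.r), l = a.comp b hab ∧ a.d = m ∧ b.d = n := by
  obtain ⟨⟨y, f, g⟩, ⟨h1, h2, h3⟩, -⟩ := Λ.factorisation l.hom m n h
  refine ⟨⟨y, l.r, f⟩, ⟨l.s, y, g⟩, rfl, ?_, h2, h3⟩
  obtain ⟨a, b, q⟩ := l
  simp only [Path.comp, eqToHom_refl, Category.id_comp]
  exact congrArg _ h1.symm

theorem Path.left_eq_of_comp_eq {a b a' b' : Λ.Path} {h : a.s = b.r} {h' : a'.s = b'.r}
    (heq : a.comp b h = a'.comp b' h') (hd : a.d = a'.d) (hd' : b.d = b'.d) : a = a' := by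
  obtain ⟨x, z, f⟩ := a
  obtain ⟨y, x₁, g⟩ := b
  obtain ⟨x', z', f'⟩ := a'
  obtain ⟨y', x₁', g'⟩ := b'
  dsimp only at h h'
  subst h h'
  simp only [Path.comp, eqToHom_refl, Category.id_comp, Path.mk.injEq] at heq
  obtain ⟨rfl, rfl, h⟩ := heq
  have h := eq_of_heq h
  have := (Λ.factorisation (g ≫ f) (Λ.deg f) (Λ.deg g) (Λ.deg_comp f g)).unique
    (y₁ := ⟨x, f, g⟩) (y₂ := ⟨x', f', g'⟩) ⟨rfl, rfl, rfl⟩ ⟨h.symm, hd.symm, hd'.symm⟩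
  obtain ⟨rfl, h2⟩ := Sigma.mk.inj_iff.1 this
  rw [(Prod.mk.inj (eq_of_heq h2)).1]

/-- The set `vΛ^n` of paths of degree `n` and range `v`. -/
def pathsTo (Λ : KGraph k V) (v : V) (n : Fin k → ℕ) : Set Λ.Path := {l | l.r = v ∧ l.d = n}

/-- `Λ` is row-finite: every `vΛ^n` is finite. -/
class RowFinite (Λ : KGraph k V) : Prop where
  finite : ∀ (v : V) (n : Fin k → ℕ), (Λ.pathsTo v n).Finite

/-- `Λ` has no sources: every `vΛ^n` is non-empty. -/
class NoSources (Λ : KGraph k V) : Prop where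
  nonempty : ∀ (v : V) (n : Fin k → ℕ), (Λ.pathsTo v n).Nonempty

/-- The set `Λ^min(μ, ν)` of pairs `(η, ζ)` with `μη = νζ` of degree `d(μ) ∨ d(ν)`. -/
def minExt (μ ν : Λ.Path) : Set (Λ.Path × Λ.Path) :=
  {p | ∃ (h₁ : μ.s = p.1.r) (h₂ : ν.s = p.2.r),
    μ.comp p.1 h₁ = ν.comp p.2 h₂ ∧ (μ.comp p.1 h₁).d = μ.d ⊔ ν.d}

/-- The set `MCE(μ, ν)` of minimal common extensions of `μ` and `ν`. -/
def mce (μ ν : Λ.Path) : Set Λ.Path :=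
  {σ | σ.d = μ.d ⊔ ν.d ∧ (∃ (α : Λ.Path) (h : μ.s = α.r), σ = μ.comp α h) ∧
    ∃ (β : Λ.Path) (h : ν.s = β.r), σ = ν.comp β h}

/-- A finite exhaustive set: a finite set `E` of paths with common range `r(E)`, such that every
path with range `r(E)` has a common extension with an element of `E`. -/
structure FiniteExhaustive (Λ : KGraph k V) where
  carrier : Finset Λ.Path
  range : V
  subset : ∀ l ∈ carrier, l.r = range
  exhaustive : ∀ μ : Λ.Path, μ.r = range → ∃ l ∈ carrier, (mce μ l).Nonempty

section RowFinite

variable [hΛ : Λ.RowFinite]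

variable (Λ) in
/-- The finite set `vΛ^n` in a row-finite `k`-graph. -/
noncomputable def paths (v : V) (n : Fin k → ℕ) : Finset Λ.Path := (hΛ.finite v n).toFinset

theorem mem_paths {v : V} {n : Fin k → ℕ} {l : Λ.Path} :
    l ∈ Λ.paths v n ↔ l.r = v ∧ l.d = n := (hΛ.finite v n).mem_toFinset

theorem finite_minExt (μ ν : Λ.Path) : (minExt μ ν).Finite := by
  refine ((hΛ.finite μ.s (μ.d ⊔ ν.d - μ.d)).prod (hΛ.finite ν.s (μ.d ⊔ ν.d - ν.d))).subset ?_
  rintro ⟨η, ζ⟩ ⟨h₁, h₂, h, hd⟩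
  have hd' := hd
  rw [h, Path.d_comp] at hd'
  rw [Path.d_comp] at hd
  refine ⟨⟨h₁.symm, ?_⟩, ⟨h₂.symm, ?_⟩⟩
  · exact (tsub_eq_of_eq_add_rev hd.symm).symm
  · exact (tsub_eq_of_eq_add_rev hd'.symm).symm

/-- The finite set `Λ^min(μ, ν)` in a row-finite `k`-graph. -/
noncomputable def minExtFinset (μ ν : Λ.Path) : Finset (Λ.Path × Λ.Path) :=
  (finite_minExt μ ν).toFinset

theorem mem_minExtFinset {μ ν : Λ.Path} {p : Λ.Path × Λ.Path} :
    p ∈ minExtFinset μ ν ↔ p ∈ minExt μ ν := (finite_minExt μ ν).mem_toFinset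

variable (Λ) in
/-- In a row-finite `k`-graph with no sources, `vΛ^{e_i}` is finite exhaustive. -/
noncomputable def edgesTo [Λ.NoSources] (v : V) (i : Fin k) : Λ.FiniteExhaustive where
  carrier := Λ.paths v (Pi.single i 1)
  range := v
  subset := fun _ hl => (mem_paths.1 hl).1
  exhaustive := by
    intro μ hμ
    obtain ⟨σ, hσr, hσd, hσ⟩ : ∃ σ : Λ.Path, σ.r = v ∧ σ.d = μ.d ⊔ Pi.single i 1 ∧
        ∃ (α : Λ.Path) (h : μ.s = α.r), σ = μ.comp α h := by
      by_cases hi : 1 ≤ μ.d i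
      · refine ⟨μ, hμ, ?_, Λ.vertex μ.s, rfl, μ.comp_vertex.symm⟩
        rw [eq_comm, sup_eq_left]
        intro j
        rcases eq_or_ne j i with rfl | hj
        · simpa using hi
        · simp [hj]
      · obtain ⟨f, hfr, hfd⟩ := NoSources.nonempty (Λ := Λ) μ.s (Pi.single i 1)
        refine ⟨μ.comp f hfr.symm, hμ, ?_, f, hfr.symm, rfl⟩
        rw [Path.d_comp, hfd]
        funext j
        rcases eq_or_ne j i with rfl | hj
        · simp only [Pi.add_apply, Pi.sup_apply, Pi.single_eq_same]
          omega
        · simp [hj]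
    have hle : Pi.single i 1 ≤ σ.d := hσd ▸ le_sup_right
    obtain ⟨e, β, h, he, hed, -⟩ := σ.exists_factor (Pi.single i 1) (σ.d - Pi.single i 1)
      (add_tsub_cancel_of_le hle).symm
    refine ⟨e, mem_paths.2 ⟨?_, hed⟩, σ, ?_, hσ, β, h, he⟩
    · rw [← hσr, he]; rfl
    · rw [hσd, hed]

/-! ### The Toeplitz algebra of a row-finite `k`-graph -/

/-- A Toeplitz–Cuntz–Krieger `Λ`-family in a C⋆-algebra. The inequality in the fourth relation is
the order of the C⋆-algebra: the difference has the form `c* c`. -/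
structure IsTCKFamily {B : Type*} [NonUnitalCStarAlgebra B] (T : Λ.Path → B) : Prop where
  partial_isometry : ∀ l : Λ.Path, T l * star (T l) * T l = T l
  projection : ∀ v : V, IsStarProjection (T (Λ.vertex v))
  orthogonal : ∀ v w : V, v ≠ w → T (Λ.vertex v) * T (Λ.vertex w) = 0
  map_comp : ∀ (l m : Λ.Path) (h : l.s = m.r), T l * T m = T (l.comp m h)
  star_mul_self : ∀ l : Λ.Path, star (T l) * T l = T (Λ.vertex l.s)
  sum_le : ∀ (v : V) (n : Fin k → ℕ), ∃ c : B,
    T (Λ.vertex v) - ∑ l ∈ Λ.paths v n, T l * star (T l) = star c * c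
  star_mul : ∀ μ ν : Λ.Path,
    star (T μ) * T ν = ∑ p ∈ minExtFinset μ ν, T p.1 * star (T p.2)

namespace IsTCKFamily

variable {B : Type*} [NonUnitalCStarAlgebra B] {T : Λ.Path → B}

theorem norm_le_one (hT : IsTCKFamily T) (l : Λ.Path) : ‖T l‖ ≤ 1 := by
  have hp : ∀ v : V, ‖T (Λ.vertex v)‖ ≤ 1 := fun v => by
    have h := CStarRing.norm_star_mul_self (x := T (Λ.vertex v))
    rw [(hT.projection v).isSelfAdjoint.star_eq, (hT.projection v).isIdempotentElem.eq] at h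
    nlinarith [norm_nonneg (T (Λ.vertex v))]
  have h := CStarRing.norm_star_mul_self (x := T l)
  rw [hT.star_mul_self] at h
  nlinarith [hp l.s, norm_nonneg (T l)]

theorem gap_isStarProjection (hT : IsTCKFamily T) (v : V) (n : Fin k → ℕ) :
    IsStarProjection (T (Λ.vertex v) - ∑ l ∈ Λ.paths v n, T l * star (T l)) := by
  have hv := hT.projection v
  have horth : ∀ l ∈ Λ.paths v n, ∀ m ∈ Λ.paths v n, l ≠ m → star (T l) * T m = 0 := by
    intro l hl m hm hne
    rw [hT.star_mul]
    refine Finset.sum_eq_zero fun p hp => absurd ?_ hne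
    obtain ⟨h₁, h₂, h, hd⟩ := mem_minExtFinset.1 hp
    have hlm : l.d = m.d := (mem_paths.1 hl).2.trans (mem_paths.1 hm).2.symm
    have hd' := hd
    rw [h] at hd'
    rw [Path.d_comp, hlm, sup_idem] at hd hd'
    exact Path.left_eq_of_comp_eq h hlm (add_left_cancel (hd.trans hd'.symm))
  have hvl : ∀ l ∈ Λ.paths v n, T (Λ.vertex v) * T l = T l := by
    intro l hl
    obtain ⟨rfl, -⟩ := mem_paths.1 hl
    rw [hT.map_comp _ _ rfl, Path.vertex_comp]
  have hsv : star (T (Λ.vertex v)) = T (Λ.vertex v) := hv.isSelfAdjoint.star_eq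
  set Q := ∑ l ∈ Λ.paths v n, T l * star (T l) with hQ
  have hsQ : star Q = Q := by simp [hQ, star_sum]
  have hvQ : T (Λ.vertex v) * Q = Q := by
    rw [hQ, Finset.mul_sum]
    exact Finset.sum_congr rfl fun l hl => by rw [← mul_assoc, hvl l hl]
  have hQv : Q * T (Λ.vertex v) = Q := by
    have := congrArg star hvQ
    rwa [StarMul.star_mul, hsQ, hsv] at this
  have hQQ : Q * Q = Q := by
    nth_rw 1 [hQ]
    rw [Finset.sum_mul]
    refine Finset.sum_congr rfl fun l hl => ?_
    rw [hQ, Finset.mul_sum, Finset.sum_eq_single_of_mem l hl]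
    · rw [← mul_assoc, hT.partial_isometry]
    · intro m hm hne
      rw [mul_assoc, ← mul_assoc (star (T l)), horth l hl m hm hne.symm, zero_mul, mul_zero]
  refine ⟨?_, ?_⟩
  · change (_ - _) * (_ - _) = _
    rw [sub_mul, mul_sub, mul_sub, hv.isIdempotentElem.eq, hvQ, hQv, hQQ, sub_self, sub_zero]
  · change star (_ - _) = _
    rw [star_sub, hsv, hsQ]

theorem of_injective {D : Type*} [NonUnitalCStarAlgebra D] {S : Λ.Path → D}
    (hT : IsTCKFamily T) (F : D →⋆ₙₐ[ℂ] B) (hF : Function.Injective F)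
    (hS : ∀ l, F (S l) = T l) : IsTCKFamily S := by
  have hs : ∀ (v : V) (n : Fin k → ℕ),
      IsStarProjection (S (Λ.vertex v) - ∑ l ∈ Λ.paths v n, S l * star (S l)) := by
    refine fun v n => ⟨hF ?_, hF ?_⟩
    · simpa only [map_mul, map_sub, map_sum, map_star, hS] using
        (hT.gap_isStarProjection v n).isIdempotentElem.eq
    · simpa only [map_mul, map_sub, map_sum, map_star, hS] using
        (hT.gap_isStarProjection v n).isSelfAdjoint.star_eq
  constructor
  · refine fun l => hF ?_
    simpa only [map_mul, map_star, hS] using hT.partial_isometry l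
  · refine fun v => ⟨hF ?_, hF ?_⟩
    · simpa only [map_mul, hS] using (hT.projection v).isIdempotentElem.eq
    · simpa only [map_star, hS] using (hT.projection v).isSelfAdjoint.star_eq
  · refine fun v w h => hF ?_
    simpa only [map_mul, map_zero, hS] using hT.orthogonal v w h
  · refine fun l m h => hF ?_
    simpa only [map_mul, hS] using hT.map_comp l m h
  · refine fun l => hF ?_
    simpa only [map_mul, map_star, hS] using hT.star_mul_self l
  · exact fun v n => ⟨_, by
      rw [(hs v n).isSelfAdjoint.star_eq, (hs v n).isIdempotentElem.eq]⟩
  · refine fun μ ν => hF ?_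
    simpa only [map_mul, map_sum, map_star, hS] using hT.star_mul μ ν

end IsTCKFamily

variable (Λ) in
/-- A Toeplitz–Cuntz–Krieger `Λ`-family together with the C⋆-algebra containing it. -/
structure TCKRep : Type (max u v + 1) where
  alg : Type (max u v)
  [cstar : NonUnitalCStarAlgebra alg]
  family : Λ.Path → alg
  isTCK : IsTCKFamily family

instance (ρ : Λ.TCKRep) : NonUnitalCStarAlgebra ρ.alg := ρ.cstar

variable (Λ) in
/-- The C⋆-algebra of bounded elements of the product of all C⋆-algebras carrying a
Toeplitz–Cuntz–Krieger `Λ`-family. -/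
abbrev TCKProduct : Type (max u v + 1) := lp (fun ρ : Λ.TCKRep => ρ.alg) ∞

/-- The Toeplitz–Cuntz–Krieger `Λ`-family whose components are all such families. -/
noncomputable def tckProduct (l : Λ.Path) : Λ.TCKProduct :=
  ⟨fun ρ => ρ.family l, memℓp_infty ⟨1, by rintro _ ⟨ρ, rfl⟩; exact ρ.isTCK.norm_le_one l⟩⟩

variable (Λ) in
/-- The closed ⋆-subalgebra generated by the family `tckProduct`. -/
noncomputable def toeplitzSubalgebra : NonUnitalStarSubalgebra ℂ Λ.TCKProduct :=
  (NonUnitalStarAlgebra.adjoin ℂ (Set.range (tckProduct (Λ := Λ)))).topologicalClosure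

variable (Λ) in
/-- The Toeplitz algebra `TC*(Λ)`: the C⋆-algebra generated by a universal
Toeplitz–Cuntz–Krieger `Λ`-family. The norm of a ⋆-polynomial in the generators is the supremum of
its norms in all Toeplitz–Cuntz–Krieger `Λ`-families. Every
C⋆-algebra generated by a family indexed by the paths of `Λ` has a copy in `Type (max u v)`, so
this is universal for families in C⋆-algebras of every universe, see `exists_lift`. -/
def ToeplitzAlgebra : Type (max u v + 1) := Λ.toeplitzSubalgebra

noncomputable instance : NonUnitalCStarAlgebra Λ.ToeplitzAlgebra :=
  NonUnitalStarSubalgebra.nonUnitalCStarAlgebra Λ.toeplitzSubalgebra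
    (h_closed := NonUnitalStarSubalgebra.isClosed_topologicalClosure _)

variable (Λ) in
/-- The universal Toeplitz–Cuntz–Krieger family `t` generating `TC*(Λ)`. -/
noncomputable def t (l : Λ.Path) : Λ.ToeplitzAlgebra :=
  ⟨tckProduct l, NonUnitalStarSubalgebra.le_topologicalClosure _
    (NonUnitalStarAlgebra.subset_adjoin ℂ _ ⟨l, rfl⟩)⟩

/-- The component of an element of `TC*(Λ)` in a given Toeplitz–Cuntz–Krieger family. -/
noncomputable def component (ρ : Λ.TCKRep) : Λ.ToeplitzAlgebra →⋆ₙₐ[ℂ] ρ.alg where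
  toFun x := x.1 ρ
  map_smul' _ _ := rfl
  map_zero' := rfl
  map_add' _ _ := rfl
  map_mul' _ _ := rfl
  map_star' _ := rfl

theorem component_t (ρ : Λ.TCKRep) (l : Λ.Path) : component ρ (Λ.t l) = ρ.family l := rfl

theorem ToeplitzAlgebra.ext {x y : Λ.ToeplitzAlgebra}
    (h : ∀ ρ : Λ.TCKRep, component ρ x = component ρ y) : x = y :=
  Subtype.ext (lp.ext (funext h))

/-- The generators of `TC*(Λ)` form a Toeplitz–Cuntz–Krieger family. -/
theorem isTCKFamily_t : IsTCKFamily Λ.t := by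
  have hs : ∀ (v : V) (n : Fin k → ℕ),
      IsStarProjection (Λ.t (Λ.vertex v) - ∑ l ∈ Λ.paths v n, Λ.t l * star (Λ.t l)) := by
    refine fun v n => ⟨?_, ?_⟩
    · refine ToeplitzAlgebra.ext fun ρ => ?_
      simpa only [map_mul, map_sub, map_sum, map_star, component_t] using
        (ρ.isTCK.gap_isStarProjection v n).isIdempotentElem.eq
    · refine ToeplitzAlgebra.ext fun ρ => ?_
      simpa only [map_mul, map_sub, map_sum, map_star, component_t] using
        (ρ.isTCK.gap_isStarProjection v n).isSelfAdjoint.star_eq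
  constructor
  · refine fun l => ToeplitzAlgebra.ext fun ρ => ?_
    simpa only [map_mul, map_star, component_t] using ρ.isTCK.partial_isometry l
  · refine fun v => ⟨ToeplitzAlgebra.ext fun ρ => ?_, ToeplitzAlgebra.ext fun ρ => ?_⟩
    · simpa only [map_mul, component_t] using (ρ.isTCK.projection v).isIdempotentElem.eq
    · simpa only [map_star, component_t] using (ρ.isTCK.projection v).isSelfAdjoint.star_eq
  · refine fun v w h => ToeplitzAlgebra.ext fun ρ => ?_
    simpa only [map_mul, map_zero, component_t] using ρ.isTCK.orthogonal v w h
  · refine fun l m h => ToeplitzAlgebra.ext fun ρ => ?_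
    simpa only [map_mul, component_t] using ρ.isTCK.map_comp l m h
  · refine fun l => ToeplitzAlgebra.ext fun ρ => ?_
    simpa only [map_mul, map_star, component_t] using ρ.isTCK.star_mul_self l
  · exact fun v n => ⟨_, by
      rw [(hs v n).isSelfAdjoint.star_eq, (hs v n).isIdempotentElem.eq]⟩
  · refine fun μ ν => ToeplitzAlgebra.ext fun ρ => ?_
    simpa only [map_mul, map_sum, map_star, component_t] using ρ.isTCK.star_mul μ ν

/-- The universal property of `TC*(Λ)`, for C⋆-algebras in any universe: every
Toeplitz–Cuntz–Krieger family is the image of the family `t` under a ⋆-homomorphism. -/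
theorem exists_lift {B : Type w} [NonUnitalCStarAlgebra B] {T : Λ.Path → B}
    (hT : IsTCKFamily T) : ∃ φ : Λ.ToeplitzAlgebra →⋆ₙₐ[ℂ] B, ∀ l, φ (Λ.t l) = T l := by
  let C := (NonUnitalStarAlgebra.adjoin ℂ (Set.range T)).topologicalClosure
  let _ : NonUnitalCStarAlgebra C := NonUnitalStarSubalgebra.nonUnitalCStarAlgebra C
    (h_closed := NonUnitalStarSubalgebra.isClosed_topologicalClosure _)
  have : Small.{max u v} C := small_closure_adjoin T
  obtain ⟨D, _, f, hf⟩ := NonUnitalCStarAlgebra.exists_copy.{max u v} C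
  let F : D →⋆ₙₐ[ℂ] B := (NonUnitalStarSubalgebraClass.subtype C).comp f
  have hF : Function.Injective F := Subtype.val_injective.comp hf.injective
  choose S hS' using fun l : Λ.Path => hf.surjective
    ⟨T l, NonUnitalStarSubalgebra.le_topologicalClosure _
      (NonUnitalStarAlgebra.subset_adjoin ℂ _ ⟨l, rfl⟩)⟩
  have hS : ∀ l, F (S l) = T l := fun l => congrArg Subtype.val (hS' l)
  let ρ : Λ.TCKRep := ⟨D, S, hT.of_injective F hF hS⟩
  let G : Λ.ToeplitzAlgebra →⋆ₙₐ[ℂ] D := component ρ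
  exact ⟨F.comp G, hS⟩

/-! ### Relative Cuntz–Krieger algebras -/

variable (Λ) in
/-- The product `∏_{λ ∈ E} (t_{r(E)} - t_λ t_λ*)` in `TC*(Λ)`. The factors are commuting
projections with unit `t_{r(E)}`, so neither the order of the factors nor the final factor
`t_{r(E)}` matters. -/
noncomputable def gapProduct (E : Λ.FiniteExhaustive) : Λ.ToeplitzAlgebra :=
  (E.carrier.toList.map fun l => Λ.t (Λ.vertex E.range) - Λ.t l * star (Λ.t l)).foldr (· * ·)
    (Λ.t (Λ.vertex E.range))

variable (Λ) in
/-- The closed ideal of `TC*(Λ)` generated by the products `∏_{λ ∈ E} (t_{r(E)} - t_λ t_λ*)` for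
`E ∈ 𝓕`. -/
noncomputable def relativeIdeal (𝓕 : Set Λ.FiniteExhaustive) : ClosedIdeal Λ.ToeplitzAlgebra :=
  ClosedIdeal.generatedBy (Λ.gapProduct '' 𝓕)

variable (Λ) in
/-- The relative Cuntz–Krieger algebra `C*(Λ; 𝓕)` of a collection `𝓕` of finite exhaustive
sets. -/
abbrev RelativeCK (𝓕 : Set Λ.FiniteExhaustive) : Type (max u v + 1) := (Λ.relativeIdeal 𝓕).Quotient

variable (Λ) in
/-- The closed ideal of `TC*(Λ)` generated by `t_v - ∑_{e ∈ vΛ^{e_i}} t_e t_e*` for all vertices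
`v` and all `i ∈ K`. -/
noncomputable def edgeIdeal (K : Set (Fin k)) : ClosedIdeal Λ.ToeplitzAlgebra :=
  ClosedIdeal.generatedBy {x | ∃ (v : V) (i : Fin k), i ∈ K ∧
    x = Λ.t (Λ.vertex v) - ∑ e ∈ Λ.paths v (Pi.single i 1), Λ.t e * star (Λ.t e)}

variable (Λ) in
/-- The collection `{vΛ^{e_i} : v ∈ Λ^0, i ∈ K}`. -/
def edgeCollection [Λ.NoSources] (K : Set (Fin k)) : Set Λ.FiniteExhaustive :=
  {E | ∃ (v : V) (i : Fin k), i ∈ K ∧ E = Λ.edgesTo v i}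

end RowFinite

end

end KGraph

/-! The two ideals agree because their generating sets agree element by element. Fix a vertex `v`
and some `i ∈ K`. Two distinct edges `e`, `f` in `vΛ^{e_i}` have the same degree, so a minimal
common extension would have that degree too, and unique factorisation would force `e = f`. Hence
`Λ^min(e, f)` is empty, the relation for `t_e* t_f` gives `0`, and the projections `t_e t_e*` are
mutually orthogonal. They also lie under `t_v`. For orthogonal subprojections of `t_v`, every cross
term in `∏ (t_v - t_e t_e*)` vanishes, and the product is `t_v - ∑ t_e t_e*`.

Orthogonality is `star_mul_eq_zero`, and the expansion of the product is `foldr_gap`, valid in any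
Toeplitz–Cuntz–Krieger family and for paths of any common degree. Applied to the universal family it
gives `gapProduct_edgesTo`, which identifies each generator of the relative ideal with the
corresponding generator of the edge ideal. The statement about quotients then follows formally from
equality of the ideals. -/

/-! ### Passing from equal ideals to their quotients -/

/-- Equal closed ideals have the same quotient. -/
theorem ClosedIdeal.exists_quotient_equiv_of_eq {A : Type u} [NonUnitalCStarAlgebra A]
    {I I' : ClosedIdeal A} (h : I = I') :
    ∃ φ : I.Quotient ≃⋆ₐ[ℂ] I'.Quotient, Isometry φ ∧ ∀ a : A, φ (I.toQuot a) = I'.toQuot a := by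
  -- With both ideals variables, the equality can be eliminated; the two quotients become the same
  -- C⋆-algebra and the identity is the required map.
  subst h
  exact ⟨StarAlgEquiv.refl ℂ I.Quotient, isometry_id, fun _ => rfl⟩

namespace KGraph

variable {k : ℕ} {V : Type u} [Category.{v} V] {Λ : KGraph k V} [Λ.RowFinite]

/-! ### Orthogonality of range projections and products of gaps -/

namespace IsTCKFamily

variable {B : Type*} [NonUnitalCStarAlgebra B] {T : Λ.Path → B}

/-- The sum expressing `T_l* T_m` has no terms: when the degrees agree, any pair in `Λ^min(l, m)`
would give two factorisations of one path with matching degrees, and hence `l = m`. -/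
theorem star_mul_eq_zero (hT : IsTCKFamily T) {l m : Λ.Path} (hd : l.d = m.d) (hne : l ≠ m) :
    star (T l) * T m = 0 := by
  rw [hT.star_mul]
  refine Finset.sum_eq_zero fun p hp => absurd ?_ hne
  obtain ⟨h₁, h₂, h, h₃⟩ := mem_minExtFinset.1 hp
  -- The degree of the common extension is computed through both factorisations. Each gives `m.d`
  -- plus the degree of the right factor equal to `m.d`, so the right factors have equal degree, as
  -- unique factorisation requires.
  have h₄ := h₃
  rw [h] at h₄
  rw [Path.d_comp, hd, sup_idem] at h₃ h₄
  exact Path.left_eq_of_comp_eq h hd (add_left_cancel (h₃.trans h₄.symm))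

/-- Since `r(l) l = l`, the vertex projection at `r(l)` is a left unit for the range projection of
`l`. The right-handed version below is its adjoint. -/
theorem vertex_mul_range (hT : IsTCKFamily T) (l : Λ.Path) :
    T (Λ.vertex l.r) * (T l * star (T l)) = T l * star (T l) := by
  rw [← mul_assoc, hT.map_comp _ _ rfl, Path.vertex_comp]

theorem range_mul_vertex (hT : IsTCKFamily T) (l : Λ.Path) :
    T l * star (T l) * T (Λ.vertex l.r) = T l * star (T l) := by
  simpa only [StarMul.star_mul, star_star, (hT.projection l.r).isSelfAdjoint.star_eq] using
    congrArg star (hT.vertex_mul_range l)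

/-- The product of the gap projections of distinct paths with the same range and the same degree
is the gap projection of their sum. -/
theorem foldr_gap (hT : IsTCKFamily T) (v : V) (n : Fin k → ℕ) (L : List Λ.Path) (hL : L.Nodup)
    (hmem : ∀ l ∈ L, l.r = v ∧ l.d = n) :
    (L.map fun l => T (Λ.vertex v) - T l * star (T l)).foldr (· * ·) (T (Λ.vertex v)) =
      T (Λ.vertex v) - (L.map fun l => T l * star (T l)).sum := by
  induction L with
  -- The empty product is `T_v`, not `1`: the final factor of the fold serves as the unit, so the
  -- formula also holds for an empty list.
  | nil => simp
  | cons a L ih =>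
    rw [List.nodup_cons] at hL
    obtain ⟨hav, had⟩ := hmem a List.mem_cons_self
    have hmem' : ∀ l ∈ L, l.r = v ∧ l.d = n := fun l hl => hmem l (List.mem_cons_of_mem a hl)
    have hv : T (Λ.vertex v) * (L.map fun l => T l * star (T l)).sum =
        (L.map fun l => T l * star (T l)).sum := by
      rw [← List.sum_map_mul_left]
      exact congrArg List.sum (List.map_congr_left fun l hl => by
        rw [← (hmem' l hl).1, hT.vertex_mul_range])
    -- This is the cross term in the expansion of `(T_v - T_a T_a*)(T_v - S)`, where `S` is the sum
    -- over the tail. It vanishes because `a` does not occur in the tail, so `a` is orthogonal to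
    -- each of its members.
    have ha : T a * star (T a) * (L.map fun l => T l * star (T l)).sum = 0 := by
      rw [← List.sum_map_mul_left]
      refine List.sum_eq_zero fun x hx => ?_
      obtain ⟨l, hl, rfl⟩ := List.mem_map.1 hx
      have hal : a ≠ l := fun h => hL.1 (h ▸ hl)
      rw [mul_assoc, ← mul_assoc (star (T a)),
        hT.star_mul_eq_zero (had.trans (hmem' l hl).2.symm) hal, zero_mul, mul_zero]
    have hav' := hT.range_mul_vertex a
    rw [hav] at hav'
    -- The expansion is `T_v T_v - T_v S - (T_a T_a* T_v - T_a T_a* S)`, which reduces to `T_v - S -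
    -- (T_a T_a* - 0)`.
    rw [List.map_cons, List.foldr_cons, ih hL.2 hmem', List.map_cons, List.sum_cons, sub_mul,
      mul_sub, mul_sub, (hT.projection v).isIdempotentElem.eq, hv, ha, hav']
    abel

end IsTCKFamily

/-! ### Comparison of the generators in the universal algebra -/

variable [Λ.NoSources]

/-- The elements of `vΛ^{e_i}` share range and degree, and `toList` lists them without repetition,
so `foldr_gap` applies. The arbitrary order chosen by `toList` disappears when the list sum is read
as a finite sum. -/
theorem gapProduct_edgesTo (v : V) (i : Fin k) :
    Λ.gapProduct (Λ.edgesTo v i) =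
      Λ.t (Λ.vertex v) - ∑ e ∈ Λ.paths v (Pi.single i 1), Λ.t e * star (Λ.t e) :=
  (isTCKFamily_t.foldr_gap v (Pi.single i 1) _ (Finset.nodup_toList _) fun _ hl =>
    mem_paths.1 (Finset.mem_toList.1 hl)).trans
      (congrArg (Λ.t (Λ.vertex v) - ·) (Finset.sum_map_toList _ _))

-- No ideal-theoretic argument is needed: both ideals are generated by sets indexed by the same
-- pairs `(v, i)` with `i ∈ K`, and `gapProduct_edgesTo` matches the generators, so the sets
-- themselves are equal.
variable (Λ) in
theorem relativeIdeal_edgeCollection (K : Set (Fin k)) :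
    Λ.relativeIdeal (Λ.edgeCollection K) = Λ.edgeIdeal K := by
  refine congrArg ClosedIdeal.generatedBy (Set.ext fun x => ⟨?_, ?_⟩)
  · rintro ⟨_, ⟨v, i, hi, rfl⟩, rfl⟩
    exact ⟨v, i, hi, gapProduct_edgesTo v i⟩
  · rintro ⟨v, i, hi, rfl⟩
    exact ⟨_, ⟨v, i, hi, rfl⟩, gapProduct_edgesTo v i⟩

end KGraph

theorem propositionA2 {k : ℕ} {V : Type u} [Category.{v} V] (Λ : KGraph k V) [Λ.RowFinite]
    [Λ.NoSources] (J K : Set (Fin k)) (_hJK : IsCompl J K) :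
    Λ.relativeIdeal (Λ.edgeCollection K) = Λ.edgeIdeal K ∧
    ∃ φ : Λ.RelativeCK (Λ.edgeCollection K) ≃⋆ₐ[ℂ] (Λ.edgeIdeal K).Quotient,
      Isometry φ ∧ ∀ a : Λ.ToeplitzAlgebra,
        φ ((Λ.relativeIdeal (Λ.edgeCollection K)).toQuot a) = (Λ.edgeIdeal K).toQuot a :=
  ⟨Λ.relativeIdeal_edgeCollection K,
    ClosedIdeal.exists_quotient_equiv_of_eq (Λ.relativeIdeal_edgeCollection K)⟩
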